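/- Let $M$ be a smooth (Hausdorff) manifold of dimension $2n+1$, $n\ge 0$, with an almost-cosymplectic-contact structure $(\omega,\Omega)$: a smooth 1-form $\omega$ and a smooth 2-form $\Omega$ such that $d\Omega=0$ and $\omega\wedge\Omega^n$ vanishes nowhere on $M$. Write $\Omega^\flat(Y)=i_Y\Omega$ for vectors $Y$. Let $(E,\Lambda)$ be the dual pair: $E$ is a smooth vector field and $\Lambda$ a smooth skew-symmetric 2-vector field, with $\Lambda^\sharp:T^*M\to TM$ defined by $\beta(\Lambda^\sharp(\alpha))=\Lambda(\alpha,\beta)$, such that $\Omega^\flat|_{\operatorname{im}\Lambda^\sharp}$ and $\Lambda^\sharp|_{\operatorname{im}\Omega^\flat}$ are mutually inverse, $i_E\omega=1$, $i_E\Omega=0$ and $i_\omega\Lambda=0$. For a smooth 1-form $\alpha$ and a smooth function $h$ on $M$ put $\alpha^\sharp=\Lambda^\sharp(\alpha)$ and $X_{(\alpha,h)}=\alpha^\sharp+hE$. For a vector field $X$ let $[X,\Lambda]=L_X\Lambda$ (the Schouten–Nijenhuis bracket); $X$ is an infinitesimal symmetry of $\Lambda$ if $L_X\Lambda=0$. The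 wedge product of vector fields is $(X\wedge Y)(\beta,\gamma)=\beta(X)\gamma(Y)-\beta(Y)\gamma(X)$, and $d\alpha(X,Y)=X(\alpha(Y))-Y(\alpha(X))-\alpha([X,Y])$. **(a)** A smooth vector field $X$ on $M$ is an infinitesimal symmetry of $\Lambda$ if and only if $X=X_{(\alpha,h)}$ for some smooth 1-form $\alpha$ and smooth function $h$ satisfying $$[\alpha^\sharp,\Lambda]-E\wedge(dh+h\,L_E\omega)^\sharp=0.\qquad(1)$$ **(b)** For every smooth 1-form $\alpha$ and every smooth function $h$, the field $X_{(\alpha,h)}$ is an infinitesimal symmetry of $\Lambda$ if and only if $(1)$ holds. **(c)** For every smooth 1-form $\alpha$ and every smooth function $h$, the field $X_{(\alpha,h)}$ is an infinitesimal symmetry of $\Lambda$ if and only if, for all smooth 1-forms $\beta,\gamma$ on $M$, $$d\omega(\alpha^\sharp,\beta^\sharp)+h\,d\omega(E,\beta^\sharp)+dh(\beta^\sharp)=0 \quad\text{and}\quad \alpha(E)\,d\omega(\beta^\sharp,\gamma^\sharp)-d\alpha(\beta^\sharp,\gamma^\sharp)=0 .$$ -/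

import Mathlib

open Bundle Set Function
open scoped Manifold Topology

noncomputable section

namespace AlmostCosymplectic

/-! ### Tensor fields on a manifold `M` modelled on a finite dimensional real vector space `V` -/

section Fields

variable (V : Type*) [NormedAddCommGroup V] [NormedSpace ℝ V]

/-- The tangent space `T_xM`. -/
abbrev Tan {M : Type*} [TopologicalSpace M] [ChartedSpace V M] (x : M) : Type _ :=
  TangentSpace 𝓘(ℝ, V) x

/-- The cotangent space `T_x^*M`. -/
abbrev Cotan {M : Type*} [TopologicalSpace M] [ChartedSpace V M] (x : M) : Type _ :=
  TangentSpace 𝓘(ℝ, V) x →L[ℝ] ℝ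

variable (M : Type*) [TopologicalSpace M] [ChartedSpace V M]

/-- (Not necessarily smooth) vector fields on `M`. -/
abbrev VectorFld : Type _ := (x : M) → Tan V x

/-- (Not necessarily smooth) 1-forms on `M`. -/
abbrev OneForm : Type _ := (x : M) → Cotan V x

/-- (Not necessarily smooth) `k`-forms on `M`: fields of alternating `k`-linear forms on the
tangent spaces. -/
abbrev Form (k : ℕ) : Type _ := (x : M) → Tan V x [⋀^Fin k]→L[ℝ] ℝ

/-- (Not necessarily smooth) contravariant 2-tensor fields on `M`. A contravariant 2-tensor `P` at
`x`, i.e. a bilinear form on `T_x^*M`, is given by its musical morphism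
`P^♯ : T_x^*M → T_xM`, where `P(α, β) = β(P^♯ α)`; as `T_xM` is finite dimensional, this is the
standard identification of `T_xM ⊗ T_xM` with `Hom(T_x^*M, T_xM)`. -/
abbrev Tensor20 : Type _ := (x : M) → Cotan V x →L[ℝ] Tan V x

end Fields

variable {V : Type*} [NormedAddCommGroup V] [NormedSpace ℝ V]
  {M : Type*} [TopologicalSpace M] [ChartedSpace V M]

/-- Skew symmetry `P(a, b) = - P(b, a)`: the tensor field `P` is a 2-vector field. -/
def IsSkew (P : Tensor20 V M) : Prop :=
  ∀ (x : M) (a b : Cotan V x), b (P x a) = - a (P x b)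

/-- `α^♯ = P^♯(α)`, so that `β(α^♯) = P(α, β)`. -/
def sharp (P : Tensor20 V M) (α : OneForm V M) : VectorFld V M := fun x => P x (α x)

/-- The flat of a 2-form at a point, `v ↦ v^♭ = i_v Ω = Ω(v, ·)`. -/
def flatAt (Ω : Form V M 2) (x : M) (v : Tan V x) : Cotan V x :=
  (Ω x).toContinuousMultilinearMap.toContinuousLinearMap ![v, 0] 1

theorem flatAt_apply (Ω : Form V M 2) (x : M) (v w : Tan V x) :
    flatAt Ω x v w = Ω x ![v, w] := by
  have h : update ![v, 0] 1 w = ![v, w] := by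
    ext i; fin_cases i <;> simp
  simp only [flatAt, ContinuousMultilinearMap.toContinuousLinearMap]
  exact congrArg (Ω x) h

/-- The linear form `a ↦ a(v)` on `T_x^*M`. -/
def evalAt {x : M} (v : Tan V x) : Cotan V x →L[ℝ] ℝ where
  toFun a := a v
  map_add' _ _ := rfl
  map_smul' _ _ := rfl
  cont := continuous_eval_const v

/-- The 2-vector field `X ∧ Y`, with `(X ∧ Y)(α, β) = α(X) β(Y) - α(Y) β(X)`. -/
def wedgeVec (X Y : VectorFld V M) : Tensor20 V M := fun x =>
  (evalAt (X x)).smulRight (Y x) - (evalAt (Y x)).smulRight (X x)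

theorem apply_wedgeVec (X Y : VectorFld V M) (x : M) (a b : Cotan V x) :
    b (wedgeVec X Y x a) = a (X x) * b (Y x) - a (Y x) * b (X x) := by
  simp [wedgeVec, evalAt]

/-- The vector field `X_{(α,h)} = α^♯ + h E`. -/
def splitField (E : VectorFld V M) (P : Tensor20 V M) (α : OneForm V M) (h : M → ℝ) :
    VectorFld V M := fun x => sharp P α x + h x • E x

/-! ### Smoothness: being a smooth section of the corresponding vector bundle -/

variable [IsManifold 𝓘(ℝ, V) 1 M]

open scoped ContDiff in
/-- `X` is a smooth section of `TM`. -/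
def SmoothVectorFld (X : VectorFld V M) : Prop :=
  ContMDiff 𝓘(ℝ, V) (𝓘(ℝ, V).prod 𝓘(ℝ, V)) ∞ fun x =>
    TotalSpace.mk' V (E := fun x : M => Tan V x) x (X x)

variable (V) in
open scoped ContDiff in
/-- `h` is a smooth function. -/
def SmoothFun (h : M → ℝ) : Prop := ContMDiff 𝓘(ℝ, V) 𝓘(ℝ, ℝ) ∞ h

open scoped ContDiff in
/-- `α` is a smooth section of `T^*M`. -/
def SmoothOneForm (α : OneForm V M) : Prop :=
  ContMDiff 𝓘(ℝ, V) (𝓘(ℝ, V).prod 𝓘(ℝ, V →L[ℝ] ℝ)) ∞ fun x =>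
    TotalSpace.mk' (V →L[ℝ] ℝ) (E := fun x : M => Cotan V x) x (α x)

open scoped ContDiff in
/-- `Ω` is a smooth section of `Λ^k T^*M`. -/
def SmoothForm {k : ℕ} (Ω : Form V M k) : Prop :=
  ContMDiff 𝓘(ℝ, V) (𝓘(ℝ, V).prod 𝓘(ℝ, V [⋀^Fin k]→L[ℝ] ℝ)) ∞ fun x =>
    TotalSpace.mk' (V [⋀^Fin k]→L[ℝ] ℝ)
      (E := fun x : M => Tan V x [⋀^Fin k]→L[ℝ] ℝ) x (Ω x)

open scoped ContDiff in
/-- `P` is a smooth section of `TM ⊗ TM = Hom(T^*M, TM)`. -/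
def SmoothTensor20 (P : Tensor20 V M) : Prop :=
  ContMDiff 𝓘(ℝ, V) (𝓘(ℝ, V).prod 𝓘(ℝ, (V →L[ℝ] ℝ) →L[ℝ] V)) ∞ fun x =>
    TotalSpace.mk' ((V →L[ℝ] ℝ) →L[ℝ] V)
      (E := fun x : M => Cotan V x →L[ℝ] Tan V x) x (P x)

/-! ### Exterior derivative and Lie derivatives

At a point `x`, these are computed from the coordinate expressions of the fields in the chart
around `x`. -/

/-- The differential at `z` of the chart around `x₀`, `T_zM → V` (for `z` in its domain). -/
def chartDiff (x₀ z : M) : Tan V z →L[ℝ] V :=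
  (trivializationAt V (fun z : M => Tan V z) x₀).continuousLinearMapAt ℝ z

/-- The inverse `V → T_zM` of the differential at `z` of the chart around `x₀`. -/
def chartDiffSymm (x₀ z : M) : V →L[ℝ] Tan V z :=
  (trivializationAt V (fun z : M => Tan V z) x₀).symmL ℝ z

/-- The coordinate expression, in the chart around `x₀`, of a vector field. Like the two definitions
below, it matters only on the image of that chart. -/
def vectorExpr (X : VectorFld V M) (x₀ : M) (y : V) : V :=
  let z := (extChartAt 𝓘(ℝ, V) x₀).symm y
  chartDiff x₀ z (X z)

/-- The coordinate expression, in the chart around `x₀`, of a `k`-form. -/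
def formExpr {k : ℕ} (Ω : Form V M k) (x₀ : M) (y : V) : V [⋀^Fin k]→L[ℝ] ℝ :=
  let z := (extChartAt 𝓘(ℝ, V) x₀).symm y
  (Ω z).compContinuousLinearMap (chartDiffSymm x₀ z)

/-- The coordinate expression, in the chart around `x₀`, of a contravariant 2-tensor field. -/
def tensorExpr (P : Tensor20 V M) (x₀ : M) (y : V) : (V →L[ℝ] ℝ) →L[ℝ] V :=
  let z := (extChartAt 𝓘(ℝ, V) x₀).symm y
  (chartDiff x₀ z).comp ((P z).comp (ContinuousLinearMap.precomp ℝ (chartDiff x₀ z)))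

/-- The exterior derivative of a `k`-form. -/
def extD {k : ℕ} (Ω : Form V M k) : Form V M (k + 1) := fun x =>
  (extDeriv (formExpr Ω x) (extChartAt 𝓘(ℝ, V) x x)).compContinuousLinearMap (chartDiff x x)

/-- A 1-form as an alternating form of degree one. -/
def OneForm.toForm (α : OneForm V M) : Form V M 1 := fun x =>
  ContinuousAlternatingMap.ofSubsingleton ℝ (Tan V x) ℝ (0 : Fin 1) (α x)

/-- The exterior derivative of a 1-form,
`dα(X, Y) = X(α(Y)) - Y(α(X)) - α([X, Y])`. -/
def dOne (α : OneForm V M) : Form V M 2 := extD α.toForm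

/-- The differential of a function. -/
def dFun (h : M → ℝ) : OneForm V M := fun x => mvfderiv 𝓘(ℝ, V) h x

/-- The Lie derivative of a 1-form along a vector field, `L_X α = i_X dα + d (i_X α)`. -/
def lieOne (X : VectorFld V M) (α : OneForm V M) : OneForm V M := fun x =>
  flatAt (dOne α) x (X x) + dFun (fun z => α z (X z)) x

/-- Precomposition with a linear endomorphism of `V`, on linear forms. -/
def transposeL (A : V →L[ℝ] V) : (V →L[ℝ] ℝ) →L[ℝ] (V →L[ℝ] ℝ) :=
  (ContinuousLinearMap.compL ℝ V V ℝ).flip A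

/-- The Lie derivative `L_X P` along a vector field `X` of a contravariant 2-tensor field `P`;
when `P` is a 2-vector field this is the Schouten-Nijenhuis bracket `[X, P]`. In coordinates,
`(L_X P)^{ij} = X^k ∂_k P^{ij} - P^{ik} ∂_k X^j - P^{kj} ∂_k X^i`, that is,
`(L_X P)^♯ = (D P^♯)(X) - DX ∘ P^♯ - P^♯ ∘ (DX)^*`. -/
def lieBracketTensor (X : VectorFld V M) (P : Tensor20 V M) : Tensor20 V M := fun x =>
  let y : V := extChartAt 𝓘(ℝ, V) x x
  let X' : V → V := vectorExpr X x
  let P' : V → (V →L[ℝ] ℝ) →L[ℝ] V := tensorExpr P x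
  let L : (V →L[ℝ] ℝ) →L[ℝ] V :=
    fderiv ℝ P' y (X' y) - (fderiv ℝ X' y).comp (P' y) - (P' y).comp (transposeL (fderiv ℝ X' y))
  (chartDiffSymm x x).comp (L.comp (ContinuousLinearMap.precomp ℝ (chartDiffSymm x x)))

/-! ### Almost-cosymplectic-contact structures and their duals -/

/-- The top degree form `ω ∧ Ω^n` at `x`, evaluated on `2n + 1` tangent vectors:
`(ω ∧ Ω^n)(v₀, …, v₂ₙ) = 2⁻ⁿ ∑_σ sgn(σ) ω(v_{σ(0)}) ∏_{i<n} Ω(v_{σ(2i+1)}, v_{σ(2i+2)})`. -/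
def topWedge (n : ℕ) (ω : OneForm V M) (Ω : Form V M 2) (x : M)
    (v : Fin (2 * n + 1) → Tan V x) : ℝ :=
  (2 ^ n : ℝ)⁻¹ * ∑ σ : Equiv.Perm (Fin (2 * n + 1)),
    ((Equiv.Perm.sign σ : ℤ) : ℝ) * (ω x (v (σ 0)) *
      ∏ i : Fin n, Ω x ![v (σ ⟨2 * (i : ℕ) + 1, by omega⟩), v (σ ⟨2 * (i : ℕ) + 2, by omega⟩)])

/-- `(ω, Ω)` is a (regular) almost-cosymplectic-contact structure on the `(2n+1)`-dimensional
manifold `M`: `dΩ = 0` and `ω ∧ Ω^n` vanishes nowhere. -/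
structure IsAlmostCosymplecticContact (n : ℕ) (ω : OneForm V M) (Ω : Form V M 2) : Prop where
  smooth_oneForm : SmoothOneForm ω
  smooth_twoForm : SmoothForm Ω
  closed : ∀ x, extD Ω x = 0
  regular : ∀ x, ∃ v, topWedge n ω Ω x v ≠ 0

/-- `(E, Λ)`, a vector field and a 2-vector field, is dual to `(ω, Ω)`:
`Λ^♯ : im Ω^♭ → im Λ^♯` and `Ω^♭ : im Λ^♯ → im Ω^♭` are mutually inverse, `i_E ω = 1`, `i_E Ω = 0`
and `i_ω Λ = 0`. -/
structure IsDualPair (ω : OneForm V M) (Ω : Form V M 2) (E : VectorFld V M) (Λ : Tensor20 V M) :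
    Prop where
  smooth_field : SmoothVectorFld E
  smooth_tensor : SmoothTensor20 Λ
  skew : IsSkew Λ
  inverse : ∀ x, InvOn (Λ x) (flatAt Ω x) (range (Λ x)) (range (flatAt Ω x))
  oneForm_reeb : ∀ x, ω x (E x) = 1
  twoForm_reeb : ∀ x, flatAt Ω x (E x) = 0
  sharp_oneForm : ∀ x, sharp Λ ω x = 0

end AlmostCosymplectic

end

/-! The pair (ω, Ω) determines (E, Λ), so L_XΛ can be read off from L_Xω and L_XΩ. Regularity gives
ker ω ∩ ker Ω^♭ = 0, which with the duality relations yields Λ^♯Ω^♭v = v - ω(v)E. By skewness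
Ω^♭Λ^♯a = a - a(E)ω, so every covector is Ω^♭v + cω with v ∈ ker ω, and a 2-vector vanishes as soon
as its values on the pairs (Ω^♭v, Ω^♭u) and (Ω^♭v, ω) do (`eq_zero_of_skew`). Differentiating the
first identity shows that for L_XΛ these values are (L_XΩ)(v, u) and -(L_Xω)(v).

For X = α^♯ + hE one has ω(X) = h and i_XΩ = α - α(E)ω. As dΩ = 0, Cartan's formula gives on ker ω
that L_XΩ = dα - α(E)dω and L_Xω = i_X dω + dh. Since ker ω = im Λ^♯, this is (c)
(`lieCoord_split_eq_zero_iff`).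

The same test gives L_EΛ = -E ∧ (L_Eω)^♯ (`lieCoord_reeb`). With the Leibniz rule L_{hE}Λ = hL_EΛ -
E ∧ (dh)^♯, the left side of (1) is equal to L_XΛ (`lieCoord_split`), which is (b). For (a), every X
is X_{(α,h)} with α = i_XΩ and h = ω(X).

All the calculus is done in a chart, at the point representing x. -/

namespace AlmostCosymplectic

/-! ### Lie derivatives in a normed space -/

section LinearModel

variable {V : Type*} [NormedAddCommGroup V] [NormedSpace ℝ V]

/-- The coordinate expression at `y` of the Lie derivative of a contravariant 2-tensor field. -/
noncomputable def lieCoord (P : V → (V →L[ℝ] ℝ) →L[ℝ] V) (X : V → V) (y : V) :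
    (V →L[ℝ] ℝ) →L[ℝ] V :=
  fderiv ℝ P y (X y) - (fderiv ℝ X y).comp (P y) - (P y).comp (transposeL (fderiv ℝ X y))

theorem lieCoord_apply (P : V → (V →L[ℝ] ℝ) →L[ℝ] V) (X : V → V) (y : V) (a : V →L[ℝ] ℝ) :
    lieCoord P X y a =
      fderiv ℝ P y (X y) a - fderiv ℝ X y (P y a) - P y (a.comp (fderiv ℝ X y)) := rfl

/-- The exterior derivative of a 1-form on `V`. -/
noncomputable def dCoord (a : V → V →L[ℝ] ℝ) (y u v : V) : ℝ :=
  fderiv ℝ a y u v - fderiv ℝ a y v u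

/-- An almost-cosymplectic-contact pair `(w, B)` near a point `y` of `V`, with dual pair `(e, P)`;
the 2-form `B` is given by its flat map. -/
structure IsLocalDualPair (w : V → V →L[ℝ] ℝ) (B : V → V →L[ℝ] V →L[ℝ] ℝ) (e : V → V)
    (P : V → (V →L[ℝ] ℝ) →L[ℝ] V) (y : V) : Prop where
  diff_oneForm : DifferentiableAt ℝ w y
  diff_twoForm : DifferentiableAt ℝ B y
  diff_field : DifferentiableAt ℝ e y
  diff_tensor : DifferentiableAt ℝ P y
  skew_tensor : ∀ᶠ z in 𝓝 y, ∀ a b : V →L[ℝ] ℝ, b (P z a) = - a (P z b)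
  skew_twoForm : ∀ z u v, B z u v = - B z v u
  sharp_flat : ∀ᶠ z in 𝓝 y, ∀ v, P z (B z v) = v - w z v • e z
  sharp_oneForm : ∀ᶠ z in 𝓝 y, P z (w z) = 0
  twoForm_reeb : ∀ᶠ z in 𝓝 y, B z (e z) = 0
  oneForm_reeb : ∀ᶠ z in 𝓝 y, w z (e z) = 1
  closed : ∀ u v s, fderiv ℝ B y u v s - fderiv ℝ B y v u s + fderiv ℝ B y s u v = 0

theorem fderiv_clm_apply_const {F G : Type*} [NormedAddCommGroup F] [NormedSpace ℝ F]
    [NormedAddCommGroup G] [NormedSpace ℝ G] {A : V → F →L[ℝ] G} {y : V}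
    (hA : DifferentiableAt ℝ A y) (c : F) (u : V) :
    fderiv ℝ (fun z => A z c) y u = fderiv ℝ A y u c := by
  rw [fderiv_clm_apply hA (differentiableAt_const c)]; simp

theorem fderiv_clm_apply_apply {F G : Type*} [NormedAddCommGroup F] [NormedSpace ℝ F]
    [NormedAddCommGroup G] [NormedSpace ℝ G] {A : V → F →L[ℝ] G} {f : V → F} {y : V}
    (hA : DifferentiableAt ℝ A y) (hf : DifferentiableAt ℝ f y) (u : V) :
    fderiv ℝ (fun z => A z (f z)) y u = A y (fderiv ℝ f y u) + fderiv ℝ A y u (f y) := by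
  rw [fderiv_clm_apply hA hf]; simp

theorem fderiv_smul_apply {F : Type*} [NormedAddCommGroup F] [NormedSpace ℝ F] {h : V → ℝ}
    {f : V → F} {y : V} (hh : DifferentiableAt ℝ h y) (hf : DifferentiableAt ℝ f y) (u : V) :
    fderiv ℝ (fun z => h z • f z) y u = h y • fderiv ℝ f y u + fderiv ℝ h y u • f y := by
  rw [fderiv_fun_smul hh hf]; simp

theorem fderiv_skew_tensor {P : V → (V →L[ℝ] ℝ) →L[ℝ] V} {y : V}
    (hP : DifferentiableAt ℝ P y)
    (hs : ∀ᶠ z in 𝓝 y, ∀ a b : V →L[ℝ] ℝ, b (P z a) = - a (P z b)) (u : V) (a b : V →L[ℝ] ℝ) :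
    b (fderiv ℝ P y u a) = - a (fderiv ℝ P y u b) := by
  have key (a b : V →L[ℝ] ℝ) : fderiv ℝ (fun z => b (P z a)) y u = b (fderiv ℝ P y u a) := by
    have hPa : DifferentiableAt ℝ (fun z => P z a) y := hP.clm_apply (differentiableAt_const a)
    have := (b.hasFDerivAt.comp y hPa.hasFDerivAt).fderiv
    rw [show (fun z => b (P z a)) = b ∘ fun z => P z a from rfl, this]
    simp [fderiv_clm_apply_const hP]
  have h : (fun z => b (P z a)) =ᶠ[𝓝 y] fun z => -(a (P z b)) := hs.mono fun z hz => hz a b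
  rw [← key, ← key, h.fderiv_eq, fderiv_fun_neg]
  rfl

theorem lieCoord_skew {P : V → (V →L[ℝ] ℝ) →L[ℝ] V} {y : V}
    (hP : DifferentiableAt ℝ P y)
    (hs : ∀ᶠ z in 𝓝 y, ∀ a b : V →L[ℝ] ℝ, b (P z a) = - a (P z b)) (X : V → V)
    (a b : V →L[ℝ] ℝ) :
    b (lieCoord P X y a) = - a (lieCoord P X y b) := by
  have h := hs.self_of_nhds
  simp only [lieCoord_apply, map_sub]
  rw [fderiv_skew_tensor hP hs _ a b, h (a.comp _) b, h (b.comp _) a]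
  simp only [ContinuousLinearMap.comp_apply]
  ring

theorem lieCoord_congr {P : V → (V →L[ℝ] ℝ) →L[ℝ] V} {X Y : V → V} {y : V} (h : X =ᶠ[𝓝 y] Y) :
    lieCoord P X y = lieCoord P Y y := by
  rw [lieCoord, lieCoord, h.fderiv_eq, h.self_of_nhds]

theorem lieCoord_add {P : V → (V →L[ℝ] ℝ) →L[ℝ] V} {X Y : V → V} {y : V}
    (hX : DifferentiableAt ℝ X y) (hY : DifferentiableAt ℝ Y y) :
    lieCoord P (fun z => X z + Y z) y = lieCoord P X y + lieCoord P Y y := by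
  ext1 a
  rw [add_apply]
  simp only [lieCoord_apply]
  rw [fderiv_fun_add hX hY, (fderiv ℝ P y).map_add, add_apply, add_apply,
    ContinuousLinearMap.comp_add, map_add (P y)]
  abel

/-- Leibniz rule L_{hX}Λ = h L_XΛ - X ∧ (dh)^♯. Skewness is what turns the term dh(a^♯) into
-a((dh)^♯). -/
theorem lieCoord_smul {P : V → (V →L[ℝ] ℝ) →L[ℝ] V} {h : V → ℝ} {X : V → V} {y : V}
    (hs : ∀ a b : V →L[ℝ] ℝ, b (P y a) = - a (P y b))
    (hh : DifferentiableAt ℝ h y) (hX : DifferentiableAt ℝ X y) (a : V →L[ℝ] ℝ) :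
    lieCoord P (fun z => h z • X z) y a = h y • lieCoord P X y a
      - (a (X y) • P y (fderiv ℝ h y) - a (P y (fderiv ℝ h y)) • X y) := by
  have hc : a.comp (fderiv ℝ (fun z => h z • X z) y)
      = h y • a.comp (fderiv ℝ X y) + a (X y) • fderiv ℝ h y := by
    ext u
    simp [fderiv_smul_apply hh hX, mul_comm]
  simp only [lieCoord_apply]
  rw [hc, fderiv_smul_apply hh hX, (fderiv ℝ P y).map_smul, smul_apply, map_add (P y),
    map_smul (P y), map_smul (P y), hs a (fderiv ℝ h y), neg_smul, smul_sub, smul_sub]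
  abel

/-! ### Local almost-cosymplectic-contact pairs -/

namespace IsLocalDualPair

variable {w : V → V →L[ℝ] ℝ} {B : V → V →L[ℝ] V →L[ℝ] ℝ} {e : V → V}
  {P : V → (V →L[ℝ] ℝ) →L[ℝ] V} {y : V} (H : IsLocalDualPair w B e P y)
include H

/-- The transpose of `sharp_flat`, as both tensors are skew. -/
theorem flat_sharp : ∀ᶠ z in 𝓝 y, ∀ a : V →L[ℝ] ℝ, B z (P z a) = a - a (e z) • w z := by
  filter_upwards [H.skew_tensor, H.sharp_flat] with z hs hf a
  ext v
  rw [H.skew_twoForm, hs a, hf]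
  simp [mul_comm]

theorem oneForm_sharp (a : V →L[ℝ] ℝ) : w y (P y a) = 0 := by
  rw [H.skew_tensor.self_of_nhds, H.sharp_oneForm.self_of_nhds]; simp

theorem flat_apply_reeb (v : V) : B y v (e y) = 0 := by
  rw [H.skew_twoForm, H.twoForm_reeb.self_of_nhds]; simp

theorem sharp_flat_of_mem {v : V} (hv : w y v = 0) : P y (B y v) = v := by
  rw [H.sharp_flat.self_of_nhds, hv]; simp

theorem flat_sharp_apply {u : V} (hu : w y u = 0) (c : V →L[ℝ] ℝ) :
    B y u (P y c) = - c u := by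
  rw [H.skew_tensor.self_of_nhds, H.sharp_flat_of_mem hu]

/-- By `flat_sharp` the covectors split as Ω^♭(ker ω) ⊕ ℝω. The component of S on (ω, ω) vanishes by
skewness, so only the two listed types of components remain. -/
theorem eq_zero_of_skew {S : (V →L[ℝ] ℝ) →L[ℝ] V} (hS : ∀ a b : V →L[ℝ] ℝ, b (S a) = - a (S b))
    (hBB : ∀ v u, w y v = 0 → w y u = 0 → B y u (S (B y v)) = 0)
    (hwB : ∀ v, w y v = 0 → w y (S (B y v)) = 0) : S = 0 := by
  have hdec (a : V →L[ℝ] ℝ) : a = B y (P y a) + a (e y) • w y := by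
    rw [H.flat_sharp.self_of_nhds]; simp
  have hww : w y (S (w y)) = 0 := by linarith [hS (w y) (w y)]
  have hBw (v) (hv : w y v = 0) : B y v (S (w y)) = 0 := by rw [hS, hwB v hv, neg_zero]
  have hz (a b : V →L[ℝ] ℝ) : b (S a) = 0 := by
    rw [hdec a, hdec b]
    simp [hBB, hBw, hwB, hww, H.oneForm_sharp]
  ext1 a
  by_contra hne
  obtain ⟨b, hb⟩ := SeparatingDual.exists_ne_zero (R := ℝ) hne
  exact hb (hz a b)

/-- Differentiate Λ^♯Ω^♭v = v - ω(v)E with v constant; the derivative of E drops out because its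
factor ω(v) is zero at the point. -/
theorem fderiv_tensor_flat {v : V} (hv : w y v = 0) (u : V) :
    fderiv ℝ P y u (B y v) = - P y (fderiv ℝ B y u v) - fderiv ℝ w y u v • e y := by
  have hBv : DifferentiableAt ℝ (fun z => B z v) y :=
    H.diff_twoForm.clm_apply (differentiableAt_const v)
  have hwv : DifferentiableAt ℝ (fun z => w z v) y :=
    H.diff_oneForm.clm_apply (differentiableAt_const v)
  have h : (fun z => P z (B z v)) =ᶠ[𝓝 y] fun z => v - w z v • e z :=
    H.sharp_flat.mono fun z hz => hz v
  have h' := congrArg (fun L : V →L[ℝ] V => L u) h.fderiv_eq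
  simp only [fderiv_clm_apply_apply H.diff_tensor hBv, fderiv_clm_apply_const H.diff_twoForm,
    fderiv_const_sub, neg_apply, fderiv_smul_apply hwv H.diff_field, hv,
    fderiv_clm_apply_const H.diff_oneForm, zero_smul, zero_add] at h'
  rw [sub_eq_add_neg, ← h']
  abel

/-- The right side is (L_XΩ)(v, u): Λ inverts Ω on ker ω, and the E-term from `fderiv_tensor_flat`
is killed by i_EΩ = 0. -/
theorem flat_lieCoord_flat (X : V → V) {v u : V} (hv : w y v = 0) (hu : w y u = 0) :
    B y u (lieCoord P X y (B y v)) = fderiv ℝ B y (X y) v u + B y (fderiv ℝ X y v) u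
      + B y v (fderiv ℝ X y u) := by
  rw [lieCoord_apply, H.fderiv_tensor_flat hv, H.sharp_flat_of_mem hv]
  simp only [map_sub, map_neg, map_smul, H.flat_sharp_apply hu, H.flat_apply_reeb]
  rw [H.skew_twoForm y u (fderiv ℝ X y v)]
  simp

/-- The right side is -(L_Xω)(v): ω kills the terms in im Λ^♯, while the E-term survives because
ω(E) = 1. -/
theorem oneForm_lieCoord_flat (X : V → V) {v : V} (hv : w y v = 0) :
    w y (lieCoord P X y (B y v)) = - (fderiv ℝ w y (X y) v + w y (fderiv ℝ X y v)) := by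
  rw [lieCoord_apply, H.fderiv_tensor_flat hv, H.sharp_flat_of_mem hv]
  simp only [map_sub, map_neg, map_smul, H.oneForm_sharp, H.oneForm_reeb.self_of_nhds]
  simp only [smul_eq_mul]
  ring

/-- Cartan's formula for `ω` along a vector field. -/
theorem lie_oneForm {X : V → V} (hX : DifferentiableAt ℝ X y) (v : V) :
    fderiv ℝ w y (X y) v + w y (fderiv ℝ X y v)
      = dCoord w y (X y) v + fderiv ℝ (fun z => w z (X z)) y v := by
  rw [fderiv_clm_apply_apply H.diff_oneForm hX, dCoord]
  ring

/-- Cartan's formula for the closed form `Ω`, on `ker ω`, along a vector field `X` with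
`i_X Ω = α - α(E) ω`. -/
theorem lie_twoForm {X : V → V} {a : V → V →L[ℝ] ℝ} (hX : DifferentiableAt ℝ X y)
    (ha : DifferentiableAt ℝ a y)
    (h : ∀ᶠ z in 𝓝 y, B z (X z) = a z - a z (e z) • w z)
    {v u : V} (hv : w y v = 0) (hu : w y u = 0) :
    fderiv ℝ B y (X y) v u + B y (fderiv ℝ X y v) u + B y v (fderiv ℝ X y u)
      = dCoord a y v u - a y (e y) * dCoord w y v u := by
  have hae : DifferentiableAt ℝ (fun z => a z (e z)) y := ha.clm_apply H.diff_field
  have haw : DifferentiableAt ℝ (fun z => a z (e z) • w z) y := hae.smul H.diff_oneForm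
  -- Differentiate `h` along s and evaluate on t: the derivative of α(E) comes with the factor ω(t)
  -- = 0. Antisymmetrizing in v, u and using dΩ(X, v, u) = 0 then gives the formula.
  have key {s t : V} (ht : w y t = 0) :
      B y (fderiv ℝ X y s) t + fderiv ℝ B y s (X y) t
        = fderiv ℝ a y s t - a y (e y) * fderiv ℝ w y s t := by
    have h' := congrArg (fun L : V →L[ℝ] V →L[ℝ] ℝ => L s t) (Filter.EventuallyEq.fderiv_eq h)
    rw [fderiv_fun_sub ha haw] at h'
    simpa [fderiv_clm_apply_apply H.diff_twoForm hX, fderiv_smul_apply hae H.diff_oneForm, ht]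
      using h'
  have h1 := key (s := v) hu
  have h2 := key (s := u) hv
  have h3 := H.closed (X y) v u
  rw [H.skew_twoForm y (fderiv ℝ X y u) v] at h2
  simp only [dCoord]
  linarith

theorem eventually_flat_split (a : V → V →L[ℝ] ℝ) (h : V → ℝ) :
    ∀ᶠ z in 𝓝 y, B z (P z (a z) + h z • e z) = a z - a z (e z) • w z := by
  filter_upwards [H.flat_sharp, H.twoForm_reeb] with z h1 h2
  rw [map_add, h1, map_smul, h2]; simp

theorem lieCoord_split_eq_zero_iff {a : V → V →L[ℝ] ℝ} {h : V → ℝ}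
    (ha : DifferentiableAt ℝ a y) (hh : DifferentiableAt ℝ h y) :
    lieCoord P (fun z => P z (a z) + h z • e z) y = 0 ↔
      ∀ b c : V →L[ℝ] ℝ,
        dCoord w y (P y (a y)) (P y b) + h y * dCoord w y (e y) (P y b)
            + fderiv ℝ h y (P y b) = 0 ∧
          a y (e y) * dCoord w y (P y b) (P y c) - dCoord a y (P y b) (P y c) = 0 := by
  set X : V → V := fun z => P z (a z) + h z • e z with hXdef
  have hX : DifferentiableAt ℝ X y :=
    (H.diff_tensor.clm_apply ha).add (hh.smul H.diff_field)
  have hwX : (fun z => w z (X z)) =ᶠ[𝓝 y] h := by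
    filter_upwards [H.skew_tensor, H.sharp_oneForm, H.oneForm_reeb] with z h1 h2 h3
    simp [X, h1 (a z) (w z), h2, h3]
  have h1 {v : V} (hv : w y v = 0) : w y (lieCoord P X y (B y v)) =
      - (dCoord w y (P y (a y)) v + h y * dCoord w y (e y) v + fderiv ℝ h y v) := by
    rw [H.oneForm_lieCoord_flat X hv, H.lie_oneForm hX, hwX.fderiv_eq]
    simp only [X, dCoord, map_add, map_smul, add_apply,
      smul_apply, smul_eq_mul]
    ring
  have h2 {v u : V} (hv : w y v = 0) (hu : w y u = 0) : B y u (lieCoord P X y (B y v)) =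
      - (a y (e y) * dCoord w y v u - dCoord a y v u) := by
    rw [H.flat_lieCoord_flat X hv hu, H.lie_twoForm hX ha (H.eventually_flat_split a h) hv hu]
    ring
  constructor
  · intro h0 b c
    have e1 := h1 (H.oneForm_sharp b)
    have e2 := h2 (H.oneForm_sharp b) (H.oneForm_sharp c)
    rw [h0] at e1 e2
    simp only [zero_apply, map_zero] at e1 e2
    exact ⟨by linarith, by linarith⟩
  · intro h0
    refine H.eq_zero_of_skew (lieCoord_skew H.diff_tensor H.skew_tensor X) ?_ ?_
    · intro v u hv hu
      have := (h0 (B y v) (B y u)).2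
      rw [H.sharp_flat_of_mem hv, H.sharp_flat_of_mem hu] at this
      rw [h2 hv hu, this, neg_zero]
    · intro v hv
      -- The first condition does not involve c, so c = 0 serves as a dummy.
      have := (h0 (B y v) 0).1
      rw [H.sharp_flat_of_mem hv] at this
      rw [h1 hv, this, neg_zero]

/-- The Lie derivative of `Λ` along `E` is `- E ∧ (L_E ω)^♯`. -/
theorem lieCoord_reeb {l : V →L[ℝ] ℝ} (hl : ∀ v, l v = dCoord w y (e y) v) (a : V →L[ℝ] ℝ) :
    lieCoord P e y a = - (a (e y) • P y l - a (P y l) • e y) := by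
  set S : (V →L[ℝ] ℝ) →L[ℝ] V := lieCoord P e y
    + ((ContinuousLinearMap.apply ℝ ℝ (e y)).smulRight (P y l)
      - (ContinuousLinearMap.apply ℝ ℝ (P y l)).smulRight (e y)) with hS
  have hSa (a : V →L[ℝ] ℝ) : S a = lieCoord P e y a + (a (e y) • P y l - a (P y l) • e y) := by
    simp [hS]
  have hwe : (fun z => w z (e z)) =ᶠ[𝓝 y] fun _ => 1 := H.oneForm_reeb
  -- The correction E ∧ (L_Eω)^♯ vanishes on pairs from Ω^♭(ker ω), since these annihilate E. On
  -- (Ω^♭v, ω) it equals (L_Eω)(v), which cancels the value found for L_EΛ.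
  have hS0 : S = 0 := by
    refine H.eq_zero_of_skew ?_ ?_ ?_
    · intro a b
      simp only [hSa, map_add, map_sub, map_smul, smul_eq_mul]
      rw [lieCoord_skew H.diff_tensor H.skew_tensor e a b]
      ring
    · intro v u hv hu
      -- As i_EΩ = 0, `lie_twoForm` applies to X = E with α = 0.
      have h0 : ∀ᶠ z in 𝓝 y, B z (e z) = (0 : V → V →L[ℝ] ℝ) z
          - (0 : V → V →L[ℝ] ℝ) z (e z) • w z := by
        filter_upwards [H.twoForm_reeb] with z hz
        simp [hz]
      rw [hSa, map_add, H.flat_lieCoord_flat e hv hu,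
        H.lie_twoForm H.diff_field (differentiableAt_const 0) h0 hv hu]
      simp [dCoord, H.flat_apply_reeb]
    · intro v hv
      rw [hSa, map_add, H.oneForm_lieCoord_flat e hv, H.lie_oneForm H.diff_field,
        hwe.fderiv_eq, H.flat_sharp_apply hv, hl]
      simp [H.flat_apply_reeb, H.oneForm_reeb.self_of_nhds]
  have := congrArg (fun L : (V →L[ℝ] ℝ) →L[ℝ] V => L a) hS0
  simp only [hSa, zero_apply] at this
  exact eq_neg_of_add_eq_zero_left this

theorem lieCoord_split {a : V → V →L[ℝ] ℝ} {h : V → ℝ} {l : V →L[ℝ] ℝ}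
    (ha : DifferentiableAt ℝ a y) (hh : DifferentiableAt ℝ h y)
    (hl : ∀ v, l v = dCoord w y (e y) v) (b : V →L[ℝ] ℝ) :
    lieCoord P (fun z => P z (a z) + h z • e z) y b = lieCoord P (fun z => P z (a z)) y b
      - (b (e y) • P y (fderiv ℝ h y + h y • l) - b (P y (fderiv ℝ h y + h y • l)) • e y) := by
  have hhe : DifferentiableAt ℝ (fun z => h z • e z) y := hh.smul H.diff_field
  rw [lieCoord_add (H.diff_tensor.clm_apply ha) hhe, add_apply,
    lieCoord_smul H.skew_tensor.self_of_nhds hh H.diff_field,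
    H.lieCoord_reeb hl]
  simp only [map_add, map_smul, smul_add, add_smul, smul_neg, smul_sub, smul_eq_mul, mul_smul,
    smul_comm (h y)]
  abel

end IsLocalDualPair

end LinearModel

/-! ### Nondegeneracy from ω ∧ Ωⁿ ≠ 0 -/

section Regular

variable {W : Type*} [AddCommGroup W] [Module ℝ W]

/-- A top degree alternating form vanishing on all tuples that contain a given nonzero vector is
zero. -/
theorem _root_.AlternatingMap.eq_zero_of_map_eq_zero_of_mem {m : ℕ} (hm : Module.finrank ℝ W = m)
    (hpos : 0 < m) (A : W [⋀^Fin m]→ₗ[ℝ] ℝ) {u : W} (hu : u ≠ 0)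
    (hA : ∀ v : Fin m → W, ∀ i, v i = u → A v = 0) : A = 0 := by
  have : FiniteDimensional ℝ W := .of_finrank_pos (hm ▸ hpos)
  have hli : LinearIndepOn ℝ id ({u} : Set W) := LinearIndepOn.singleton hu
  let b := Module.Basis.extend hli
  have : Fintype (hli.extend (subset_univ _)) := FiniteDimensional.fintypeBasisIndex b
  refine Module.Basis.ext_alternating b fun v hv => ?_
  -- An injective family of m basis vectors exhausts the basis, which was chosen to contain u.
  have hbij : Bijective v := by
    rw [Fintype.bijective_iff_injective_and_card]
    exact ⟨hv, by rw [Fintype.card_fin, ← hm, Module.finrank_eq_card_basis b]⟩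
  obtain ⟨i, hi⟩ := hbij.2 ⟨u, hli.subset_extend _ (mem_singleton u)⟩
  refine hA _ i ?_
  rw [hi]
  exact Module.Basis.extend_apply_self hli _

/-- The multilinear map `f ⊗ b ⊗ ⋯ ⊗ b`. -/
def tensorPow (n : ℕ) (f : W →ₗ[ℝ] ℝ) (b : W →ₗ[ℝ] W →ₗ[ℝ] ℝ) :
    MultilinearMap ℝ (fun _ : Fin (2 * n + 1) => W) ℝ :=
  -- Slot j occurs in exactly one factor: in f if j = 0, else in the left or right argument of one
  -- copy of b according to the parity of j.
  have key (v : Fin (2 * n + 1) → W) (j : Fin (2 * n + 1)) : ∃ l : W →ₗ[ℝ] ℝ, ∀ x,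
      f (update v j x 0) * ∏ i : Fin n, b (update v j x ⟨2 * (i : ℕ) + 1, by omega⟩)
        (update v j x ⟨2 * (i : ℕ) + 2, by omega⟩) = l x := by
    have hne (x : W) (m : ℕ) (hm : m < 2 * n + 1) (h : (j : ℕ) ≠ m) :
        update v j x ⟨m, hm⟩ = v ⟨m, hm⟩ :=
      update_of_ne (fun e => h (congrArg Fin.val e).symm) _ _
    have hself (x : W) (m : ℕ) (hm : m < 2 * n + 1) (h : (j : ℕ) = m) :
        update v j x ⟨m, hm⟩ = x := by
      rw [show (⟨m, hm⟩ : Fin (2 * n + 1)) = j from Fin.ext h.symm, update_self]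
    have hne0 (x : W) (h : (j : ℕ) ≠ 0) : update v j x 0 = v 0 := hne x 0 (Nat.succ_pos _) h
    have hprod (k : Fin n) (x : W)
        (h : ∀ i : Fin n, i ≠ k → (j : ℕ) ≠ 2 * (i : ℕ) + 1 ∧ (j : ℕ) ≠ 2 * (i : ℕ) + 2) :
        ∏ i : Fin n, b (update v j x ⟨2 * (i : ℕ) + 1, by omega⟩)
          (update v j x ⟨2 * (i : ℕ) + 2, by omega⟩) =
        b (update v j x ⟨2 * (k : ℕ) + 1, by omega⟩) (update v j x ⟨2 * (k : ℕ) + 2, by omega⟩) *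
        ∏ i ∈ Finset.univ.erase k,
          b (v ⟨2 * (i : ℕ) + 1, by omega⟩) (v ⟨2 * (i : ℕ) + 2, by omega⟩) := by
      rw [← Finset.mul_prod_erase _ _ (Finset.mem_univ k)]
      congr 1
      refine Finset.prod_congr rfl fun i hi => ?_
      obtain ⟨h1, h2⟩ := h i (Finset.ne_of_mem_erase hi)
      rw [hne x _ _ h1, hne x _ _ h2]
    obtain h0 | ⟨k, hk⟩ | ⟨k, hk⟩ : (j : ℕ) = 0 ∨ (∃ k : Fin n, (j : ℕ) = 2 * (k : ℕ) + 1) ∨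
        ∃ k : Fin n, (j : ℕ) = 2 * (k : ℕ) + 2 := by
      rcases Nat.even_or_odd' (j : ℕ) with ⟨c, hc | hc⟩
      · rcases Nat.eq_zero_or_pos c with rfl | hpos
        · exact Or.inl hc
        · exact Or.inr (Or.inr ⟨⟨c - 1, by omega⟩, by simp only; omega⟩)
      · exact Or.inr (Or.inl ⟨⟨c, by omega⟩, hc⟩)
    · refine ⟨(∏ i : Fin n, b (v ⟨2 * (i : ℕ) + 1, by omega⟩)
        (v ⟨2 * (i : ℕ) + 2, by omega⟩)) • f, fun x => ?_⟩
      have h0' : update v j x 0 = x := hself x 0 (Nat.succ_pos _) h0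
      rw [h0', LinearMap.smul_apply, smul_eq_mul, mul_comm]
      congr 1
      refine Finset.prod_congr rfl fun i _ => ?_
      rw [hne x _ _ (by omega), hne x _ _ (by omega)]
    · refine ⟨(f (v 0) * ∏ i ∈ Finset.univ.erase k, b (v ⟨2 * (i : ℕ) + 1, by omega⟩)
        (v ⟨2 * (i : ℕ) + 2, by omega⟩)) • b.flip (v ⟨2 * (k : ℕ) + 2, by omega⟩), fun x => ?_⟩
      rw [hprod k x fun i hi => by have := Fin.val_ne_of_ne hi; omega, hne0 x (by omega),
        hself x _ _ hk, hne x _ _ (by omega)]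
      simp only [LinearMap.smul_apply, LinearMap.flip_apply, smul_eq_mul]
      ring
    · refine ⟨(f (v 0) * ∏ i ∈ Finset.univ.erase k, b (v ⟨2 * (i : ℕ) + 1, by omega⟩)
        (v ⟨2 * (i : ℕ) + 2, by omega⟩)) • b (v ⟨2 * (k : ℕ) + 1, by omega⟩), fun x => ?_⟩
      rw [hprod k x fun i hi => by have := Fin.val_ne_of_ne hi; omega, hne0 x (by omega),
        hself x _ _ hk, hne x _ _ (by omega)]
      simp only [LinearMap.smul_apply, smul_eq_mul]
      ring
  { toFun v := f (v 0) * ∏ i : Fin n, b (v ⟨2 * (i : ℕ) + 1, by omega⟩)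
      (v ⟨2 * (i : ℕ) + 2, by omega⟩)
    map_update_add' := by
      intro inst v j x y
      obtain rfl := Subsingleton.elim inst (instDecidableEqFin _)
      obtain ⟨l, hl⟩ := key v j
      rw [hl, hl, hl, map_add]
    map_update_smul' := by
      intro inst v j c x
      obtain rfl := Subsingleton.elim inst (instDecidableEqFin _)
      obtain ⟨l, hl⟩ := key v j
      rw [hl, hl, map_smul] }

theorem tensorPow_apply (n : ℕ) (f : W →ₗ[ℝ] ℝ) (b : W →ₗ[ℝ] W →ₗ[ℝ] ℝ)
    (v : Fin (2 * n + 1) → W) :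
    tensorPow n f b v = f (v 0) * ∏ i : Fin n, b (v ⟨2 * (i : ℕ) + 1, by omega⟩)
      (v ⟨2 * (i : ℕ) + 2, by omega⟩) := rfl

theorem tensorPow_eq_zero {n : ℕ} {f : W →ₗ[ℝ] ℝ} {b : W →ₗ[ℝ] W →ₗ[ℝ] ℝ} {u : W}
    (hf : f u = 0) (hl : ∀ v, b u v = 0) (hr : ∀ v, b v u = 0)
    {v : Fin (2 * n + 1) → W} {j : Fin (2 * n + 1)} (hj : v j = u) : tensorPow n f b v = 0 := by
  rw [tensorPow_apply]
  rcases Nat.even_or_odd' (j : ℕ) with ⟨c, hc | hc⟩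
  · rcases Nat.eq_zero_or_pos c with rfl | hpos
    · obtain rfl : j = 0 := Fin.ext hc
      rw [hj, hf, zero_mul]
    · rw [Finset.prod_eq_zero (i := ⟨c - 1, by omega⟩) (Finset.mem_univ _), mul_zero]
      rw [show (⟨2 * (c - 1) + 2, by omega⟩ : Fin (2 * n + 1)) = j from Fin.ext (by simp; omega),
        hj, hr]
  · rw [Finset.prod_eq_zero (i := ⟨c, by omega⟩) (Finset.mem_univ _), mul_zero]
    rw [show (⟨2 * c + 1, by omega⟩ : Fin (2 * n + 1)) = j from Fin.ext (by simp; omega), hj, hl]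

/-- If `f ∧ bⁿ` does not vanish on a `(2n+1)`-dimensional space, then `ker f ∩ ker b = 0`. -/
theorem eq_zero_of_wedge_ne_zero {n : ℕ} (hdim : Module.finrank ℝ W = 2 * n + 1)
    {f : W →ₗ[ℝ] ℝ} {b : W →ₗ[ℝ] W →ₗ[ℝ] ℝ}
    (hne : ∃ v : Fin (2 * n + 1) → W, ∑ σ : Equiv.Perm (Fin (2 * n + 1)),
      ((Equiv.Perm.sign σ : ℤ) : ℝ) * tensorPow n f b (v ∘ σ) ≠ 0)
    {u : W} (hf : f u = 0) (hl : ∀ v, b u v = 0) (hr : ∀ v, b v u = 0) : u = 0 := by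
  by_contra hu
  obtain ⟨v, hv⟩ := hne
  have hA (v : Fin (2 * n + 1) → W) : MultilinearMap.alternatization (tensorPow n f b) v =
      ∑ σ : Equiv.Perm (Fin (2 * n + 1)),
        ((Equiv.Perm.sign σ : ℤ) : ℝ) * tensorPow n f b (v ∘ σ) := by
    rw [MultilinearMap.alternatization_apply]
    refine Finset.sum_congr rfl fun σ _ => ?_
    rw [MultilinearMap.domDomCongr_apply, Units.smul_def, zsmul_eq_mul]
    rfl
  have h0 := AlternatingMap.eq_zero_of_map_eq_zero_of_mem hdim (Nat.succ_pos _)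
    (MultilinearMap.alternatization (tensorPow n f b)) hu fun v i hi => by
      rw [hA]
      refine Finset.sum_eq_zero fun σ _ => ?_
      rw [tensorPow_eq_zero hf hl hr (j := σ.symm i) (by simpa using hi), mul_zero]
  rw [← hA, h0] at hv
  exact hv rfl

end Regular

/-! ### Coordinate expressions in the chart around a point -/

section Charts

set_option synthInstance.maxHeartbeats 200000

variable {V : Type*} [NormedAddCommGroup V] [NormedSpace ℝ V]
  {M : Type*} [TopologicalSpace M] [ChartedSpace V M]

/-- The point of `V` representing `x` in the chart around `x`. -/
noncomputable abbrev chartPt (V : Type*) [NormedAddCommGroup V] [NormedSpace ℝ V]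
    {M : Type*} [TopologicalSpace M] [ChartedSpace V M] (x : M) : V := extChartAt 𝓘(ℝ, V) x x

theorem symm_chartPt (x : M) : (extChartAt 𝓘(ℝ, V) x).symm (chartPt V x) = x :=
  extChartAt_to_inv x

theorem eventually_mem_source (x : M) :
    ∀ᶠ y in 𝓝 (chartPt V x), (extChartAt 𝓘(ℝ, V) x).symm y ∈ (chartAt V x).source := by
  filter_upwards [extChartAt_target_mem_nhds (I := 𝓘(ℝ, V)) x] with y hy
  simpa using (extChartAt 𝓘(ℝ, V) x).map_target hy

open scoped ContDiff in
theorem differentiableAt_comp_chart {F : Type*} [NormedAddCommGroup F] [NormedSpace ℝ F]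
    {f : M → F} {x : M} (hf : ContMDiffAt 𝓘(ℝ, V) 𝓘(ℝ, F) ∞ f x) :
    DifferentiableAt ℝ (fun y => f ((extChartAt 𝓘(ℝ, V) x).symm y)) (chartPt V x) := by
  have h := (contMDiffAt_iff.1 hf).2
  simp only [ModelWithCorners.range_eq_univ, contDiffWithinAt_univ] at h
  exact h.differentiableAt (by simp)

theorem SmoothFun.differentiableAt {h : M → ℝ} (hh : SmoothFun V h) (x : M) :
    DifferentiableAt ℝ (fun y => h ((extChartAt 𝓘(ℝ, V) x).symm y)) (chartPt V x) :=
  differentiableAt_comp_chart (hh x)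

theorem dFun_apply {h : M → ℝ} (hh : SmoothFun V h) (x : M) (v : V) :
    dFun (V := V) h x v
      = fderiv ℝ (fun y => h ((extChartAt 𝓘(ℝ, V) x).symm y)) (chartPt V x) v := by
  have hd : MDifferentiableAt 𝓘(ℝ, V) 𝓘(ℝ, ℝ) h x := (hh x).mdifferentiableAt (by simp)
  have : mfderiv 𝓘(ℝ, V) 𝓘(ℝ, ℝ) h x
      = fderiv ℝ (fun y => h ((extChartAt 𝓘(ℝ, V) x).symm y)) (chartPt V x) := by
    rw [hd.mfderiv, ModelWithCorners.range_eq_univ, fderivWithin_univ]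
    rfl
  exact congrArg (fun L : V →L[ℝ] ℝ => L v) this

variable [IsManifold 𝓘(ℝ, V) ((⊤ : ℕ∞) : WithTop ℕ∞) M]

/-- The fibre T_xM is V as read in the preferred chart at x, so this coordinate change is trivial.
Hence values at x need no conversion. -/
theorem chartDiff_self (x : M) (v : V) : chartDiff (V := V) x x v = v := by
  rw [chartDiff, TangentBundle.continuousLinearMapAt_trivializationAt_eq_core (mem_chart_source V x)]
  exact (tangentBundleCore 𝓘(ℝ, V) M).coordChange_self _ _ (mem_chart_source V x) v

theorem chartDiffSymm_self (x : M) (v : V) : chartDiffSymm (V := V) x x v = v := by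
  rw [chartDiffSymm, TangentBundle.symmL_trivializationAt_eq_core (mem_chart_source V x)]
  exact (tangentBundleCore 𝓘(ℝ, V) M).coordChange_self _ _ (mem_chart_source V x) v

theorem chartDiffSymm_chartDiff {x z : M} (hz : z ∈ (chartAt V x).source) (v : Tan V z) :
    chartDiffSymm x z (chartDiff x z v) = v :=
  (trivializationAt V (fun z : M => Tan V z) x).symmL_continuousLinearMapAt hz v

theorem chartDiff_chartDiffSymm {x z : M} (hz : z ∈ (chartAt V x).source) (v : V) :
    chartDiff x z (chartDiffSymm x z v) = v :=
  (trivializationAt V (fun z : M => Tan V z) x).continuousLinearMapAt_symmL hz v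

/-- The coordinate expression, in the chart around `x₀`, of a 1-form. -/
noncomputable def oneFormExpr (α : OneForm V M) (x₀ : M) (y : V) : V →L[ℝ] ℝ :=
  let z := (extChartAt 𝓘(ℝ, V) x₀).symm y
  (α z).comp (chartDiffSymm x₀ z)

theorem vectorExpr_self (X : VectorFld V M) (x : M) : vectorExpr X x (chartPt V x) = X x := by
  -- The base point occurs in types, so it is generalized to z before `symm_chartPt` is used.
  have h : ∀ z, z = x → (chartDiff x z (X z) : V) = X x := by
    rintro z rfl; exact chartDiff_self (V := V) z (X z)
  exact h _ (symm_chartPt x)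

theorem oneFormExpr_self (α : OneForm V M) (x : M) : oneFormExpr α x (chartPt V x) = α x := by
  have h : ∀ z, z = x → ((α z).comp (chartDiffSymm x z) : V →L[ℝ] ℝ) = α x := by
    rintro z rfl
    ext v
    exact congrArg (α z) (chartDiffSymm_self z v)
  exact h _ (symm_chartPt x)

theorem tensorExpr_apply (P : Tensor20 V M) (x : M) (y : V) (a : V →L[ℝ] ℝ) :
    tensorExpr P x y a = chartDiff x ((extChartAt 𝓘(ℝ, V) x).symm y)
      (P ((extChartAt 𝓘(ℝ, V) x).symm y) (a.comp (chartDiff x _))) := rfl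

theorem tensorExpr_self (P : Tensor20 V M) (x : M) (a : V →L[ℝ] ℝ) :
    tensorExpr P x (chartPt V x) a = P x a := by
  have h : ∀ z, z = x → (chartDiff x z (P z (a.comp (chartDiff x z))) : V) = P x a := by
    rintro z rfl
    have ha : (a.comp (chartDiff z z) : V →L[ℝ] ℝ) = a := by
      ext v; exact congrArg a (chartDiff_self z v)
    exact (chartDiff_self (V := V) z _).trans (congrArg (P z) ha)
  exact h _ (symm_chartPt x)

theorem tensorExpr_oneFormExpr (P : Tensor20 V M) (α : OneForm V M) {x : M} {y : V}
    (hy : (extChartAt 𝓘(ℝ, V) x).symm y ∈ (chartAt V x).source) :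
    tensorExpr P x y (oneFormExpr α x y) = vectorExpr (sharp P α) x y := by
  rw [tensorExpr_apply, vectorExpr, sharp]
  congr 2
  ext v
  exact congrArg (α _) (chartDiffSymm_chartDiff hy v)

theorem lieBracketTensor_apply (X : VectorFld V M) (P : Tensor20 V M) (x : M) (a : V →L[ℝ] ℝ) :
    lieBracketTensor X P x a = lieCoord (tensorExpr P x) (vectorExpr X x) (chartPt V x) a := by
  have ha : (a.comp (chartDiffSymm x x) : V →L[ℝ] ℝ) = a := by
    ext v; exact congrArg a (chartDiffSymm_self x v)
  refine (chartDiffSymm_self x _).trans ?_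
  exact congrArg (lieCoord (tensorExpr P x) (vectorExpr X x) (chartPt V x)) ha

theorem lieBracketTensor_eq_zero_iff (X : VectorFld V M) (P : Tensor20 V M) (x : M) :
    lieBracketTensor X P x = 0 ↔ lieCoord (tensorExpr P x) (vectorExpr X x) (chartPt V x) = 0 := by
  constructor
  · intro h
    ext1 a
    rw [← lieBracketTensor_apply, h]
    rfl
  · intro h
    ext1 a
    refine (lieBracketTensor_apply X P x a).trans ?_
    rw [h]
    rfl

/-! ### Smooth sections in coordinates -/

section Smoothness

open scoped ContDiff

theorem SmoothVectorFld.contMDiffAt {X : VectorFld V M} (hX : SmoothVectorFld X) (x : M) :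
    ContMDiffAt 𝓘(ℝ, V) 𝓘(ℝ, V) ∞ (fun z => (chartDiff x z (X z) : V)) x := by
  refine ((contMDiffAt_section x).1 (hX x)).congr_of_eventuallyEq ?_
  filter_upwards [(chartAt V x).open_source.mem_nhds (mem_chart_source V x)] with z hz
  exact (trivializationAt V (fun z : M => Tan V z) x).continuousLinearMapAt_apply_of_mem ℝ hz _

theorem smoothOneForm_iff {α : OneForm V M} :
    SmoothOneForm α ↔ ∀ x, ContMDiffAt 𝓘(ℝ, V) 𝓘(ℝ, V →L[ℝ] ℝ) ∞
      (fun z => ((α z).comp (chartDiffSymm x z) : V →L[ℝ] ℝ)) x := by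
  refine forall_congr' fun x => (contMDiffAt_section x).trans ?_
  refine iff_of_eq (congrArg (fun f => ContMDiffAt _ _ _ f x) (funext fun z => ?_))
  ext v
  rw [hom_trivializationAt_apply]
  simp [ContinuousLinearMap.inCoordinates, chartDiffSymm]

theorem SmoothForm.contMDiffAt {k : ℕ} {Ω : Form V M k} (hΩ : SmoothForm Ω) (x : M) :
    ContMDiffAt 𝓘(ℝ, V) 𝓘(ℝ, V [⋀^Fin k]→L[ℝ] ℝ) ∞
      (fun z => ((Ω z).compContinuousLinearMap (chartDiffSymm x z) : V [⋀^Fin k]→L[ℝ] ℝ)) x := by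
  refine ((contMDiffAt_section x).1 (hΩ x)).congr_of_eventuallyEq ?_
  refine Filter.Eventually.of_forall fun z => ?_
  ext v
  simp only [FiberBundle.trivializationAt_continuousAlternatingMap_apply]
  simp [ContinuousAlternatingMap.inCoordinates, chartDiffSymm]

theorem SmoothTensor20.contMDiffAt {P : Tensor20 V M} (hP : SmoothTensor20 P) (x : M) :
    ContMDiffAt 𝓘(ℝ, V) 𝓘(ℝ, (V →L[ℝ] ℝ) →L[ℝ] V) ∞
      (fun z => ((chartDiff x z).comp ((P z).comp
        (ContinuousLinearMap.precomp ℝ (chartDiff x z))) : (V →L[ℝ] ℝ) →L[ℝ] V)) x := by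
  refine ((contMDiffAt_section x).1 (hP x)).congr_of_eventuallyEq ?_
  filter_upwards [(chartAt V x).open_source.mem_nhds (mem_chart_source V x)] with z hz
  ext a
  rw [hom_trivializationAt_apply]
  -- The inverse cotangent trivialization is pullback by the chart differential, since the
  -- trivialization sends that pullback back to a.
  have ha : (trivializationAt (V →L[ℝ] ℝ) (fun z : M => Cotan V z) x).symmL ℝ z a
      = a.comp (chartDiff x z) := by
    set t := trivializationAt (V →L[ℝ] ℝ) (fun z : M => Cotan V z) x
    have hzt : z ∈ t.baseSet := by
      simpa [t] using hz
    have h : t.continuousLinearMapAt ℝ z (a.comp (chartDiff x z)) = a := by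
      rw [t.continuousLinearMapAt_apply_of_mem ℝ hzt]
      ext v
      rw [hom_trivializationAt_apply]
      simp only [ContinuousLinearMap.inCoordinates, ContinuousLinearMap.comp_apply]
      refine Eq.trans ?_ (congrArg a (chartDiff_chartDiffSymm hz v))
      exact congrArg (fun L : ℝ →L[ℝ] ℝ => L _)
        (Bundle.Trivial.continuousLinearMapAt_trivialization ℝ M ℝ z)
    rw [← h, t.symmL_continuousLinearMapAt hzt]
    rw [h]
  simp only [ContinuousLinearMap.inCoordinates, ContinuousLinearMap.comp_apply]
  exact congrArg (fun b => chartDiff x z (P z b)) ha.symm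

theorem SmoothVectorFld.differentiableAt {X : VectorFld V M} (hX : SmoothVectorFld X) (x : M) :
    DifferentiableAt ℝ (vectorExpr X x) (chartPt V x) :=
  differentiableAt_comp_chart (hX.contMDiffAt x)

theorem SmoothOneForm.differentiableAt {α : OneForm V M} (hα : SmoothOneForm α) (x : M) :
    DifferentiableAt ℝ (oneFormExpr α x) (chartPt V x) :=
  differentiableAt_comp_chart (smoothOneForm_iff.1 hα x)

theorem SmoothForm.differentiableAt {k : ℕ} {Ω : Form V M k} (hΩ : SmoothForm Ω) (x : M) :
    DifferentiableAt ℝ (formExpr Ω x) (chartPt V x) :=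
  differentiableAt_comp_chart (hΩ.contMDiffAt x)

theorem SmoothTensor20.differentiableAt {P : Tensor20 V M} (hP : SmoothTensor20 P) (x : M) :
    DifferentiableAt ℝ (tensorExpr P x) (chartPt V x) :=
  differentiableAt_comp_chart (hP.contMDiffAt x)

/-- A local smooth extension is cut off by a bump function equal to 1 at x. This lets (c), stated
for global forms, be tested on covectors at a point. -/
theorem exists_smoothOneForm [FiniteDimensional ℝ V] [T2Space M] (x : M) (b : V →L[ℝ] ℝ) :
    ∃ β : OneForm V M, SmoothOneForm β ∧ β x = b := by
  let σ : (z : M) → Cotan V z := FiberBundle.extend (V →L[ℝ] ℝ) (x := x) b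
  obtain ⟨s, hs, hσ⟩ := FiberBundle.exists_contMDiffOn_extend (k := ∞) 𝓘(ℝ, V) (V →L[ℝ] ℝ)
    (V := fun z : M => Cotan V z) (x₀ := x) b
  obtain ⟨f, hf⟩ := ((SmoothBumpFunction.nhds_basis_tsupport (I := 𝓘(ℝ, V)) x).mem_iff.1
    (interior_mem_nhds.2 hs))
  refine ⟨fun z => f z • σ z, ?_, ?_⟩
  · exact ContMDiffOn.smul_section_of_tsupport f.contMDiff.contMDiffOn isOpen_interior hf.2
      (hσ.mono interior_subset)
  · have : f x = 1 := f.eq_one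
    simp only [this, one_smul, σ]
    exact FiberBundle.extend_apply_self ..

end Smoothness

/-- The bilinear form of an alternating 2-form. -/
noncomputable def bilinL (V : Type*) [NormedAddCommGroup V] [NormedSpace ℝ V] :
    (V [⋀^Fin 2]→L[ℝ] ℝ) →L[ℝ] V →L[ℝ] V →L[ℝ] ℝ :=
  (ContinuousLinearMap.compL ℝ V (V [⋀^Fin 1]→L[ℝ] ℝ) (V →L[ℝ] ℝ)
    (ContinuousAlternatingMap.ofSubsingletonLIE (𝕜 := ℝ) (E := V) (F := ℝ)
      (0 : Fin 1)).symm.toContinuousLinearEquiv.toContinuousLinearMap).comp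
    ContinuousAlternatingMap.curryLeftLI.toContinuousLinearMap

theorem bilinL_apply (A : V [⋀^Fin 2]→L[ℝ] ℝ) (u v : V) : bilinL V A u v = A ![u, v] := by
  have h : (bilinL V A u v) = A (Matrix.vecCons u fun _ => v) := rfl
  rw [h]
  refine congrArg A ?_
  ext i
  fin_cases i <;> rfl

theorem extD_apply {k : ℕ} (Ω : Form V M k) (x : M) (v : Fin (k + 1) → V) :
    extD Ω x v = extDeriv (formExpr Ω x) (chartPt V x) v := by
  refine congrArg (extDeriv (formExpr Ω x) (chartPt V x)) ?_
  ext i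
  exact chartDiff_self x (v i)

theorem formExpr_toForm (α : OneForm V M) (x : M) (y : V) (v : Fin 1 → V) :
    formExpr α.toForm x y v = oneFormExpr α x y (v 0) := rfl

theorem dOne_apply {α : OneForm V M} (hα : SmoothOneForm α) (x : M) (u v : V) :
    dOne α x ![u, v] = dCoord (oneFormExpr α x) (chartPt V x) u v := by
  have hd := hα.differentiableAt x
  have hform : formExpr α.toForm x = fun y =>
      ContinuousAlternatingMap.ofSubsingletonLIE (𝕜 := ℝ) (E := V) (F := ℝ) (0 : Fin 1) (oneFormExpr α x y) := rfl
  have hd' : DifferentiableAt ℝ (formExpr α.toForm x) (chartPt V x) := by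
    rw [hform]
    exact (ContinuousAlternatingMap.ofSubsingletonLIE (𝕜 := ℝ) (E := V) (F := ℝ)
      (0 : Fin 1)).differentiableAt.comp _ hd
  refine (extD_apply α.toForm x ![u, v]).trans ?_
  rw [extDeriv_apply hd', Fin.sum_univ_two]
  simp only [formExpr_toForm, Fin.removeNth]
  simp only [Fin.val_zero, pow_zero, one_smul, Fin.val_one, pow_one, dCoord, neg_smul]
  rw [← fderiv_clm_apply_const hd, ← fderiv_clm_apply_const hd]
  exact (sub_eq_add_neg _ _).symm

theorem differentiableAt_clm_comp {F G : Type*} [NormedAddCommGroup F] [NormedSpace ℝ F]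
    [NormedAddCommGroup G] [NormedSpace ℝ G] (A : F →L[ℝ] G) {f : V → F} {y : V}
    (hf : DifferentiableAt ℝ f y) : DifferentiableAt ℝ (fun z => A (f z)) y :=
  A.differentiableAt.comp y hf

theorem fderiv_bilinL_formExpr {Ω : Form V M 2} (hΩ : SmoothForm Ω) (x : M) (u v s : V) :
    fderiv ℝ (fun y => bilinL V (formExpr Ω x y)) (chartPt V x) u v s
      = fderiv ℝ (fun y => formExpr Ω x y ![v, s]) (chartPt V x) u := by
  have hB : DifferentiableAt ℝ (fun y => bilinL V (formExpr Ω x y)) (chartPt V x) := by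
    exact differentiableAt_clm_comp (F := V [⋀^Fin 2]→L[ℝ] ℝ) (G := V →L[ℝ] V →L[ℝ] ℝ)
      (bilinL V) (hΩ.differentiableAt x)
  simp only [← bilinL_apply]
  rw [← fderiv_clm_apply_const hB,
    ← fderiv_clm_apply_const (hB.clm_apply (differentiableAt_const v))]

theorem closed_bilinL {Ω : Form V M 2} (hΩ : SmoothForm Ω) {x : M} (hc : extD Ω x = 0)
    (u v s : V) :
    fderiv ℝ (fun y => bilinL V (formExpr Ω x y)) (chartPt V x) u v s
      - fderiv ℝ (fun y => bilinL V (formExpr Ω x y)) (chartPt V x) v u s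
      + fderiv ℝ (fun y => bilinL V (formExpr Ω x y)) (chartPt V x) s u v = 0 := by
  have h := extD_apply Ω x ![u, v, s]
  rw [hc, extDeriv_apply (hΩ.differentiableAt x), Fin.sum_univ_three] at h
  simp only [fderiv_bilinL_formExpr hΩ]
  have h0 : Fin.removeNth 0 ![u, v, s] = ![v, s] := by ext i; fin_cases i <;> rfl
  have h1 : Fin.removeNth 1 ![u, v, s] = ![u, s] := by ext i; fin_cases i <;> rfl
  have h2 : Fin.removeNth 2 ![u, v, s] = ![u, v] := by ext i; fin_cases i <;> rfl
  rw [h0, h1, h2] at h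
  have hz : (0 : V [⋀^Fin 3]→L[ℝ] ℝ) ![u, v, s] = 0 := rfl
  have h' := hz.symm.trans h
  simp at h'
  linarith

theorem smoothOneForm_flat {Ω : Form V M 2} (hΩ : SmoothForm Ω) {X : VectorFld V M}
    (hX : SmoothVectorFld X) : SmoothOneForm fun x => flatAt Ω x (X x) := by
  refine smoothOneForm_iff.2 fun x => ?_
  have hL : ContDiff ℝ ((⊤ : ℕ∞) : WithTop ℕ∞) (bilinL V) := by fun_prop
  have hB := hL.contMDiff.contMDiffAt.comp x (hΩ.contMDiffAt x)
  refine (hB.clm_apply (hX.contMDiffAt x)).congr_of_eventuallyEq ?_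
  filter_upwards [(chartAt V x).open_source.mem_nhds (mem_chart_source V x)] with z hz
  ext v
  refine (flatAt_apply Ω z (X z) (chartDiffSymm x z v)).trans ?_
  refine Eq.trans ?_ (bilinL_apply _ _ v).symm
  refine congrArg (Ω z) ?_
  ext i
  fin_cases i
  · exact (chartDiffSymm_chartDiff hz (X z)).symm
  · rfl

theorem smoothFun_apply {α : OneForm V M} (hα : SmoothOneForm α) {X : VectorFld V M}
    (hX : SmoothVectorFld X) : SmoothFun V fun x => α x (X x) := by
  intro x
  refine ((smoothOneForm_iff.1 hα x).clm_apply (hX.contMDiffAt x)).congr_of_eventuallyEq ?_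
  filter_upwards [(chartAt V x).open_source.mem_nhds (mem_chart_source V x)] with z hz
  exact congrArg (α z) (chartDiffSymm_chartDiff hz (X z)).symm

end Charts

/-! ### The dual pair in coordinates and the results on M -/

section Dual

set_option synthInstance.maxHeartbeats 200000

variable {V : Type*} [NormedAddCommGroup V] [NormedSpace ℝ V]

theorem bilinL_skew (A : V [⋀^Fin 2]→L[ℝ] ℝ) (u v : V) : bilinL V A u v = - bilinL V A v u := by
  have h := A.toAlternatingMap.map_swap ![v, u] (i := 0) (j := 1) (by decide)
  have h' : ![v, u] ∘ Equiv.swap (0 : Fin 2) 1 = ![u, v] := by ext i; fin_cases i <;> rfl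
  rw [h'] at h
  rw [bilinL_apply, bilinL_apply]
  exact h

/-- The vector v - Λ^♯Ω^♭v - ω(v)E lies in ker ω ∩ ker Ω^♭, which regularity makes trivial. -/
theorem sharp_flat_of_regular {n : ℕ} (hdim : Module.finrank ℝ V = 2 * n + 1)
    {w : V →L[ℝ] ℝ} {A : V [⋀^Fin 2]→L[ℝ] ℝ} {e : V} {L : (V →L[ℝ] ℝ) →L[ℝ] V}
    (hreg : ∃ v : Fin (2 * n + 1) → V, (2 ^ n : ℝ)⁻¹ * ∑ σ : Equiv.Perm (Fin (2 * n + 1)),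
      ((Equiv.Perm.sign σ : ℤ) : ℝ) * (w (v (σ 0)) *
        ∏ i : Fin n, A ![v (σ ⟨2 * (i : ℕ) + 1, by omega⟩), v (σ ⟨2 * (i : ℕ) + 2, by omega⟩)]) ≠ 0)
    (hskew : ∀ a b : V →L[ℝ] ℝ, b (L a) = - a (L b))
    (hinv : ∀ v, bilinL V A (L (bilinL V A v)) = bilinL V A v)
    (hwe : w e = 1) (hAe : bilinL V A e = 0) (hLw : L w = 0) (v : V) :
    L (bilinL V A v) = v - w v • e := by
  let b : V →ₗ[ℝ] V →ₗ[ℝ] ℝ := (bilinL V A).toLinearMap₁₂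
  have hb (u v : V) : b u v = A ![u, v] := bilinL_apply A u v
  have hne : ∃ v : Fin (2 * n + 1) → V, ∑ σ : Equiv.Perm (Fin (2 * n + 1)),
      ((Equiv.Perm.sign σ : ℤ) : ℝ) * tensorPow n (w : V →ₗ[ℝ] ℝ) b (v ∘ σ) ≠ 0 := by
    obtain ⟨v, hv⟩ := hreg
    refine ⟨v, ?_⟩
    simp only [tensorPow_apply, hb]
    exact right_ne_zero_of_mul hv
  have hu : bilinL V A (v - L (bilinL V A v) - w v • e) = 0 := by
    rw [map_sub, map_sub, hinv, map_smul, hAe]; simp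
  have hw : w (v - L (bilinL V A v) - w v • e) = 0 := by
    rw [map_sub, map_sub, hskew _ w, hLw, map_smul, hwe]; simp
  have h := eq_zero_of_wedge_ne_zero hdim hne (u := v - L (bilinL V A v) - w v • e) hw
    (fun t => congrArg (fun L : V →L[ℝ] ℝ => L t) hu) fun t => by
      refine (bilinL_skew A _ _).trans ?_
      rw [hu]; simp
  rw [sub_right_comm, sub_eq_zero] at h
  exact h.symm

variable {M : Type*} [TopologicalSpace M] [ChartedSpace V M]

theorem flatAt_eq_bilinL (Ω : Form V M 2) (x : M) (v : V) : flatAt Ω x v = bilinL V (Ω x) v := by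
  ext u
  exact (flatAt_apply Ω x v u).trans (bilinL_apply (V := V) (Ω x) v u).symm

variable [IsManifold 𝓘(ℝ, V) ((⊤ : ℕ∞) : WithTop ℕ∞) M]
  {n : ℕ} {ω : OneForm V M} {Ω : Form V M 2} {E : VectorFld V M} {Λ : Tensor20 V M}

theorem IsDualPair.sharp_flat (hdim : Module.finrank ℝ V = 2 * n + 1)
    (hstr : IsAlmostCosymplecticContact n ω Ω) (hdual : IsDualPair ω Ω E Λ) (x : M)
    (v : Tan V x) : Λ x (flatAt Ω x v) = v - ω x v • E x := by
  refine (congrArg (Λ x) (flatAt_eq_bilinL Ω x v)).trans ?_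
  refine sharp_flat_of_regular (V := V) hdim (hstr.regular x) (hdual.skew x) (fun v => ?_)
    (hdual.oneForm_reeb x) ?_ (hdual.sharp_oneForm x) v
  · rw [← flatAt_eq_bilinL Ω x v]
    refine (flatAt_eq_bilinL Ω x _).symm.trans ?_
    exact (hdual.inverse x).2 (mem_range_self v)
  · exact (flatAt_eq_bilinL Ω x _).symm.trans (hdual.twoForm_reeb x)

/-- Most identities hold only near the chart point, since `chartDiff` and `chartDiffSymm` are
mutually inverse only over the chart domain. -/
theorem IsDualPair.isLocalDualPair (hdim : Module.finrank ℝ V = 2 * n + 1)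
    (hstr : IsAlmostCosymplecticContact n ω Ω) (hdual : IsDualPair ω Ω E Λ) (x : M) :
    IsLocalDualPair (oneFormExpr ω x) (fun y => bilinL V (formExpr Ω x y)) (vectorExpr E x)
      (tensorExpr Λ x) (chartPt V x) where
  diff_oneForm := hstr.smooth_oneForm.differentiableAt x
  diff_twoForm := differentiableAt_clm_comp (F := V [⋀^Fin 2]→L[ℝ] ℝ) (G := V →L[ℝ] V →L[ℝ] ℝ)
    (bilinL V) (hstr.smooth_twoForm.differentiableAt x)
  diff_field := hdual.smooth_field.differentiableAt x
  diff_tensor := hdual.smooth_tensor.differentiableAt x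
  skew_tensor := Filter.Eventually.of_forall fun y a b =>
    hdual.skew _ (a.comp (chartDiff x _)) (b.comp (chartDiff x _))
  skew_twoForm y := bilinL_skew _
  sharp_flat := by
    filter_upwards [eventually_mem_source x] with y hy v
    have h : (bilinL V (formExpr Ω x y) v).comp (chartDiff x ((extChartAt 𝓘(ℝ, V) x).symm y))
        = flatAt Ω ((extChartAt 𝓘(ℝ, V) x).symm y)
          (chartDiffSymm x ((extChartAt 𝓘(ℝ, V) x).symm y) v) := by
      ext u
      refine (bilinL_apply (V := V) (formExpr Ω x y) v (chartDiff x _ u)).trans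
        (Eq.trans ?_ (flatAt_apply _ _ _ _).symm)
      refine congrArg (Ω _) ?_
      ext i
      fin_cases i
      · rfl
      · exact chartDiffSymm_chartDiff hy u
    rw [tensorExpr_apply, h, hdual.sharp_flat hdim hstr, map_sub, map_smul,
      chartDiff_chartDiffSymm hy]
    rfl
  sharp_oneForm := by
    filter_upwards [eventually_mem_source x] with y hy
    rw [tensorExpr_oneFormExpr Λ ω hy, vectorExpr]
    rw [hdual.sharp_oneForm]
    exact map_zero _
  twoForm_reeb := by
    filter_upwards [eventually_mem_source x] with y hy
    ext v
    refine (bilinL_apply (V := V) (formExpr Ω x y) (vectorExpr E x y) v).trans ?_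
    refine Eq.trans ?_ (congrArg (fun L => L (chartDiffSymm x _ v))
      (hdual.twoForm_reeb ((extChartAt 𝓘(ℝ, V) x).symm y)))
    refine Eq.trans ?_ (flatAt_apply _ _ _ _).symm
    refine congrArg (Ω _) ?_
    ext i
    fin_cases i
    · exact chartDiffSymm_chartDiff hy _
    · rfl
  oneForm_reeb := by
    filter_upwards [eventually_mem_source x] with y hy
    exact (congrArg (ω _) (chartDiffSymm_chartDiff hy _)).trans (hdual.oneForm_reeb _)
  closed := closed_bilinL hstr.smooth_twoForm (hstr.closed x)

theorem vectorExpr_sharp_eventuallyEq (P : Tensor20 V M) (α : OneForm V M) (x : M) :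
    vectorExpr (sharp P α) x =ᶠ[𝓝 (chartPt V x)] fun y => tensorExpr P x y (oneFormExpr α x y) := by
  filter_upwards [eventually_mem_source x] with y hy
  exact (tensorExpr_oneFormExpr P α hy).symm

theorem vectorExpr_splitField_eventuallyEq (E : VectorFld V M) (P : Tensor20 V M)
    (α : OneForm V M) (h : M → ℝ) (x : M) :
    vectorExpr (splitField E P α h) x =ᶠ[𝓝 (chartPt V x)] fun y =>
      tensorExpr P x y (oneFormExpr α x y)
        + h ((extChartAt 𝓘(ℝ, V) x).symm y) • vectorExpr E x y := by
  filter_upwards [eventually_mem_source x] with y hy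
  rw [tensorExpr_oneFormExpr P α hy]
  simp only [vectorExpr, splitField, map_add, map_smul]

theorem lieBracketTensor_splitField_eq_zero_iff (hdim : Module.finrank ℝ V = 2 * n + 1)
    (hstr : IsAlmostCosymplecticContact n ω Ω) (hdual : IsDualPair ω Ω E Λ) {α : OneForm V M}
    {h : M → ℝ} (hα : SmoothOneForm α) (hh : SmoothFun V h) (x : M) :
    lieBracketTensor (splitField E Λ α h) Λ x = 0 ↔ ∀ b c : Cotan V x,
      dOne ω x ![sharp Λ α x, Λ x b] + h x * dOne ω x ![E x, Λ x b] + dFun h x (Λ x b) = 0 ∧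
        α x (E x) * dOne ω x ![Λ x b, Λ x c] - dOne α x ![Λ x b, Λ x c] = 0 := by
  have H := hdual.isLocalDualPair hdim hstr x
  rw [lieBracketTensor_eq_zero_iff, lieCoord_congr (vectorExpr_splitField_eventuallyEq E Λ α h x),
    H.lieCoord_split_eq_zero_iff (hα.differentiableAt x) (hh.differentiableAt x)]
  refine forall_congr' fun b => forall_congr' fun c => ?_
  have hs : tensorExpr Λ x (chartPt V x) (oneFormExpr α x (chartPt V x)) = sharp Λ α x :=
    (tensorExpr_self Λ x _).trans (congrArg (Λ x) (oneFormExpr_self α x))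
  have hb (b : V →L[ℝ] ℝ) : tensorExpr Λ x (chartPt V x) b = Λ x b := tensorExpr_self Λ x b
  rw [hs, hb, hb, vectorExpr_self, oneFormExpr_self, symm_chartPt]
  have h1 (u v : V) : dOne ω x ![u, v] = _ := dOne_apply hstr.smooth_oneForm x u v
  have h2 (u v : V) : dOne α x ![u, v] = _ := dOne_apply hα x u v
  have h3 (v : V) : dFun h x v = _ := dFun_apply hh x v
  refine and_congr (iff_of_eq (congrArg (· = (0 : ℝ)) ?_)) (iff_of_eq (congrArg (· = (0 : ℝ)) ?_))
  · exact congrArg₂ (· + ·) (congrArg₂ (· + ·) (h1 _ _).symm (congrArg (h x * ·) (h1 _ _).symm))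
      (h3 _).symm
  · exact congrArg₂ (· - ·) (congrArg (α x (E x) * ·) (h1 _ _).symm) (h2 _ _).symm

theorem lieOne_reeb_apply (hstr : IsAlmostCosymplecticContact n ω Ω)
    (hdual : IsDualPair ω Ω E Λ) (x : M) (v : V) :
    lieOne E ω x v = dCoord (oneFormExpr ω x) (chartPt V x) (E x) v := by
  -- As ω(E) is constant, only i_E dω is left in Cartan's formula.
  have h : (fun z => ω z (E z)) = fun _ => 1 := funext hdual.oneForm_reeb
  have h0 : dFun (V := V) (M := M) (fun _ => (1 : ℝ)) x = 0 := mvfderiv_const _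
  rw [lieOne, h, h0, add_zero]
  refine (flatAt_apply (dOne ω) x (E x) v).trans ?_
  exact dOne_apply hstr.smooth_oneForm x (E x) v

theorem lieBracketTensor_splitField (hdim : Module.finrank ℝ V = 2 * n + 1)
    (hstr : IsAlmostCosymplecticContact n ω Ω) (hdual : IsDualPair ω Ω E Λ) {α : OneForm V M}
    {h : M → ℝ} (hα : SmoothOneForm α) (hh : SmoothFun V h) (x : M) :
    lieBracketTensor (splitField E Λ α h) Λ x = lieBracketTensor (sharp Λ α) Λ x
      - wedgeVec E (sharp Λ fun z => dFun h z + h z • lieOne E ω z) x := by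
  have H := hdual.isLocalDualPair hdim hstr x
  set l : V →L[ℝ] ℝ := lieOne E ω x with hl
  have hl' : ∀ v, l v = dCoord (oneFormExpr ω x) (chartPt V x) (vectorExpr E x (chartPt V x)) v := by
    intro v
    rw [vectorExpr_self]
    exact lieOne_reeb_apply hstr hdual x v
  have hd : (fderiv ℝ (fun y => h ((extChartAt 𝓘(ℝ, V) x).symm y)) (chartPt V x) + h x • l)
      = dFun h x + h x • lieOne E ω x := by
    ext v
    exact congrArg (· + h x * l v) (dFun_apply hh x v).symm
  ext1 b
  have key := H.lieCoord_split (hα.differentiableAt x) (hh.differentiableAt x) hl' b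
  rw [symm_chartPt, hd, ← lieCoord_congr (vectorExpr_splitField_eventuallyEq E Λ α h x),
    ← lieCoord_congr (vectorExpr_sharp_eventuallyEq Λ α x), vectorExpr_self, tensorExpr_self] at key
  refine (lieBracketTensor_apply _ Λ x b).trans (key.trans ?_)
  exact congrArg (· - _) (lieBracketTensor_apply _ Λ x b).symm

end Dual

end AlmostCosymplectic

/-! ### The theorem -/

open AlmostCosymplectic in
theorem theorem2p8 {V : Type*} [NormedAddCommGroup V] [NormedSpace ℝ V] [FiniteDimensional ℝ V]
    {M : Type*} [TopologicalSpace M] [T2Space M] [ChartedSpace V M]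
    [IsManifold 𝓘(ℝ, V) ((⊤ : ℕ∞) : WithTop ℕ∞) M]
    (n : ℕ) (hdim : Module.finrank ℝ V = 2 * n + 1)
    (ω : OneForm V M) (Ω : Form V M 2) (hstr : IsAlmostCosymplecticContact n ω Ω)
    (E : VectorFld V M) (Λ : Tensor20 V M) (hdual : IsDualPair ω Ω E Λ) :
    (∀ X : VectorFld V M, SmoothVectorFld X →
      ((∀ x, lieBracketTensor X Λ x = 0) ↔
        ∃ (α : OneForm V M) (h : M → ℝ), SmoothOneForm α ∧ SmoothFun V h ∧
          X = splitField E Λ α h ∧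
          ∀ x, lieBracketTensor (sharp Λ α) Λ x
            - wedgeVec E (sharp Λ fun z => dFun h z + h z • lieOne E ω z) x = 0)) ∧
    (∀ (α : OneForm V M) (h : M → ℝ), SmoothOneForm α → SmoothFun V h →
      ((∀ x, lieBracketTensor (splitField E Λ α h) Λ x = 0) ↔
        ∀ x, lieBracketTensor (sharp Λ α) Λ x
          - wedgeVec E (sharp Λ fun z => dFun h z + h z • lieOne E ω z) x = 0) ∧
      ((∀ x, lieBracketTensor (splitField E Λ α h) Λ x = 0) ↔
        ∀ β γ : OneForm V M, SmoothOneForm β → SmoothOneForm γ → ∀ x,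
          dOne ω x ![sharp Λ α x, sharp Λ β x] + h x * dOne ω x ![E x, sharp Λ β x]
              + dFun h x (sharp Λ β x) = 0 ∧
            α x (E x) * dOne ω x ![sharp Λ β x, sharp Λ γ x]
              - dOne α x ![sharp Λ β x, sharp Λ γ x] = 0)) := by
  have hsplit : ∀ (α : OneForm V M) (h : M → ℝ), SmoothOneForm α → SmoothFun V h →
      ((∀ x, lieBracketTensor (splitField E Λ α h) Λ x = 0) ↔
        ∀ x, lieBracketTensor (sharp Λ α) Λ x
          - wedgeVec E (sharp Λ fun z => dFun h z + h z • lieOne E ω z) x = 0) := fun α h hα hh =>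
    forall_congr' fun x => by rw [lieBracketTensor_splitField hdim hstr hdual hα hh x]
  refine ⟨fun X hX => ⟨fun h0 => ?_, ?_⟩, fun α h hα hh => ⟨hsplit α h hα hh, ?_⟩⟩
  · have hα := smoothOneForm_flat hstr.smooth_twoForm hX
    have hh := smoothFun_apply hstr.smooth_oneForm hX
    -- The witnesses α = i_XΩ and h = ω(X) come from X = Λ^♯Ω^♭X + ω(X)E.
    have hXeq : X = splitField E Λ (fun x => flatAt Ω x (X x)) fun x => ω x (X x) := by
      funext x
      rw [splitField, sharp, hdual.sharp_flat hdim hstr, sub_add_cancel]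
    refine ⟨_, _, hα, hh, hXeq, (hsplit _ _ hα hh).1 ?_⟩
    rwa [← hXeq]
  · rintro ⟨α, h, hα, hh, rfl, h1⟩
    exact (hsplit α h hα hh).2 h1
  · constructor
    · intro h0 β γ _ _ x
      exact (lieBracketTensor_splitField_eq_zero_iff hdim hstr hdual hα hh x).1 (h0 x) (β x) (γ x)
    · intro h0 x
      refine (lieBracketTensor_splitField_eq_zero_iff hdim hstr hdual hα hh x).2 fun b c => ?_
      obtain ⟨β, hβ, rfl⟩ := exists_smoothOneForm (V := V) x b
      obtain ⟨γ, hγ, rfl⟩ := exists_smoothOneForm (V := V) x c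
      exact h0 β γ hβ hγ x
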